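/- Let $n\ge 0$ and let $\mathfrak S_n$ be the set of permutations $\sigma=\sigma(1)\cdots\sigma(n)$ of $[n]=\{1,\dots,n\}$. **Statistics.** For $\sigma\in\mathfrak S_n$ an index $i\in[n]$ is called - a *descent* if $i<n$ and $\sigma(i)>\sigma(i+1)$; then $\sigma(i)$ is a *descent top* and $\sigma(i+1)$ a *descent bottom*; - a *descent of type 2* if it is a descent and $\sigma(j)<\sigma(i)$ for all $j<i$; - an *excedance* if $\sigma(i)>i$; a *pure excedance* if moreover $\sigma(j)\notin[i,\sigma(i)]$ for all $j<i$; a *fixed point* if $\sigma(i)=i$; - a *record* if $\sigma(j)<\sigma(i)$ for all $j<i$; an *antirecord* if $\sigma(j)>\sigma(i)$ for all $j>i$; a *cycle peak* if $\sigma^{-1}(i)<i>\sigma(i)$; - an *exclusive antirecord cycle peak* if it is an antirecord, not a record, and a cycle peak; - a *foremaximum* if it is a record and $\sigma(i-1)<\sigma(i)<\sigma(i+1)$, with the convention $\sigma(0)=0$, $\sigma(n+1)=n+1$. Let $\operatorname{des},\operatorname{des}_2,\operatorname{exc},\operatorname{pex},\operatorname{fix},\operatorname{ear},\operatorname{fmax}$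 denote the numbers of descents, descents of type 2, excedances, pure excedances, fixed points, exclusive antirecord cycle peaks and foremaxima, respectively. For a letter $x\in[n]$ put $$(31\text{-}2)(x,\sigma)=\#\{j:\ 1<j<\sigma^{-1}(x),\ \sigma(j)<x<\sigma(j-1)\}.$$ Let $T$ and $B$ be the sets of descent tops and of descent bottoms of $\sigma$, and let $T^c,B^c$ be their complements in $[n]$. **The maps.** $\Phi_1(\sigma)=\tau$ is defined as follows. For $j\in B$, taken from the largest to the smallest, $\tau(j)$ is the $((31\text{-}2)(j,\sigma)+1)$-th largest element of $T$ that is larger than $j$ and not yet chosen; for $j\in B^c$, taken from the smallest to the largest, $\tau(j)$ is the $((31\text{-}2)(j,\sigma)+1)$-th smallest element of $T^c$ that is not larger than $j$ and not yet chosen. $\Phi_2(\sigma)$ is the permutation $i\mapsto n+1-\rho(n+1-i)$, where $\rho$ is defined as follows. For $j\in T$, taken from the smallest to the largest, $\rho(j)$ is the $((31\text{-}2)(j,\sigma)+1)$-th largest element of $B$ that is smaller than $j$ and not yet chosen; for $j\in T^c$, taken from the largest to the smallest, $\rho(j)$ is the $((31\text{-}2)(j,\sigma)+1)$-th smallest element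 of $B^c$ that is not smaller than $j$ and not yet chosen. **Theorem.** These constructions define, for each $\sigma\in\mathfrak S_n$, exactly one permutation $\Phi_1(\sigma)$ and exactly one permutation $\Phi_2(\sigma)$. The maps $\Phi_1,\Phi_2:\mathfrak S_n\to\mathfrak S_n$ are bijections, and for all $\sigma\in\mathfrak S_n$ $$(\operatorname{des},\operatorname{des}_2)\,\sigma=(\operatorname{exc},\operatorname{ear})\,\Phi_1(\sigma),\qquad (\operatorname{des},\operatorname{des}_2,\operatorname{fmax})\,\sigma=(\operatorname{exc},\operatorname{pex},\operatorname{fix})\,\Phi_2(\sigma).$$ In particular, there are bijections $\Phi_1,\Phi_2$ of $\mathfrak S_n$ with these two properties. -/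

import Mathlib

/-! Permutation statistics on `𝔖ₙ`, modelled as `Equiv.Perm (Fin n)`. Positions and values are
`0, …, n - 1` in place of `1, …, n`; every notion below depends only on the order of `[n]` and on
adjacency of positions, so it is not affected by this shift. -/

namespace PermStat

variable {n : ℕ}

/-- Position `j` comes immediately after position `i`. -/
def Next (i j : Fin n) : Prop := (j : ℕ) = (i : ℕ) + 1

instance instDecidableNext (i j : Fin n) : Decidable (Next i j) :=
  inferInstanceAs (Decidable ((j : ℕ) = (i : ℕ) + 1))

/-- `i` is a descent: `i < n` and `σ(i) > σ(i+1)`. -/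
def IsDescent (σ : Equiv.Perm (Fin n)) (i : Fin n) : Prop := ∃ j, Next i j ∧ σ j < σ i

instance instDecidableIsDescent (σ : Equiv.Perm (Fin n)) (i : Fin n) :
    Decidable (IsDescent σ i) :=
  inferInstanceAs (Decidable (∃ j, Next i j ∧ σ j < σ i))

/-- `i` is a record (left-to-right maximum). -/
def IsRecord (σ : Equiv.Perm (Fin n)) (i : Fin n) : Prop := ∀ j, j < i → σ j < σ i

instance instDecidableIsRecord (σ : Equiv.Perm (Fin n)) (i : Fin n) : Decidable (IsRecord σ i) :=
  inferInstanceAs (Decidable (∀ j, j < i → σ j < σ i))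

/-- `i` is an antirecord (right-to-left minimum). -/
def IsAntirecord (σ : Equiv.Perm (Fin n)) (i : Fin n) : Prop := ∀ j, i < j → σ i < σ j

instance instDecidableIsAntirecord (σ : Equiv.Perm (Fin n)) (i : Fin n) :
    Decidable (IsAntirecord σ i) :=
  inferInstanceAs (Decidable (∀ j, i < j → σ i < σ j))

/-- `i` is a cycle peak: `σ⁻¹(i) < i > σ(i)`. -/
def IsCyclePeak (σ : Equiv.Perm (Fin n)) (i : Fin n) : Prop := σ⁻¹ i < i ∧ σ i < i

instance instDecidableIsCyclePeak (σ : Equiv.Perm (Fin n)) (i : Fin n) :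
    Decidable (IsCyclePeak σ i) :=
  inferInstanceAs (Decidable (σ⁻¹ i < i ∧ σ i < i))

/-- `σ(i)` is a double ascent: `σ(i-1) < σ(i) < σ(i+1)`, where the missing left neighbour of the
first letter counts as smaller than all letters, and the missing right neighbour of the last letter
counts as larger than all letters. -/
def IsDoubleAscent (σ : Equiv.Perm (Fin n)) (i : Fin n) : Prop :=
  (∀ k, Next k i → σ k < σ i) ∧ (∀ k, Next i k → σ i < σ k)

instance instDecidableIsDoubleAscent (σ : Equiv.Perm (Fin n)) (i : Fin n) :
    Decidable (IsDoubleAscent σ i) :=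
  inferInstanceAs (Decidable ((∀ k, Next k i → σ k < σ i) ∧ (∀ k, Next i k → σ i < σ k)))

/-- Number of descents. -/
def des (σ : Equiv.Perm (Fin n)) : ℕ := (Finset.univ.filter fun i => IsDescent σ i).card

/-- Number of descents of type 2: descents `i` with `σ(j) < σ(i)` for all `j < i`. -/
def des2 (σ : Equiv.Perm (Fin n)) : ℕ :=
  (Finset.univ.filter fun i => IsDescent σ i ∧ ∀ j, j < i → σ j < σ i).card

/-- Number of excedances. -/
def exc (σ : Equiv.Perm (Fin n)) : ℕ := (Finset.univ.filter fun i => i < σ i).card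

/-- Number of pure excedances: excedances `i` with `σ(j) ∉ [i, σ(i)]` for all `j < i`. -/
def pex (σ : Equiv.Perm (Fin n)) : ℕ :=
  (Finset.univ.filter fun i => i < σ i ∧ ∀ j, j < i → ¬ (i ≤ σ j ∧ σ j ≤ σ i)).card

/-- Number of fixed points. -/
def fixCount (σ : Equiv.Perm (Fin n)) : ℕ := (Finset.univ.filter fun i => σ i = i).card

/-- Number of exclusive antirecord cycle peaks: antirecords that are not records and are
cycle peaks. -/
def ear (σ : Equiv.Perm (Fin n)) : ℕ :=
  (Finset.univ.filter fun i => (IsAntirecord σ i ∧ ¬ IsRecord σ i) ∧ IsCyclePeak σ i).card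

/-- Number of foremaxima: double ascents that are records. -/
def fmax (σ : Equiv.Perm (Fin n)) : ℕ :=
  (Finset.univ.filter fun i => IsDoubleAscent σ i ∧ IsRecord σ i).card

/-- The set of descent tops `σ(i)`, `i` a descent. -/
def descentTops (σ : Equiv.Perm (Fin n)) : Finset (Fin n) :=
  Finset.univ.filter fun x => ∃ i j, Next i j ∧ σ j < σ i ∧ σ i = x

/-- The set of descent bottoms `σ(i+1)`, `i` a descent. -/
def descentBottoms (σ : Equiv.Perm (Fin n)) : Finset (Fin n) :=
  Finset.univ.filter fun x => ∃ i j, Next i j ∧ σ j < σ i ∧ σ j = x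

/-- `(31-2)(x, σ)`: the number of positions `j > 1` to the left of the letter `x` with
`σ(j) < x < σ(j-1)`. -/
def pat312 (x : Fin n) (σ : Equiv.Perm (Fin n)) : ℕ :=
  (Finset.univ.filter fun j => ∃ k, Next k j ∧ j < σ⁻¹ x ∧ σ j < x ∧ x < σ k).card

/-- `x` is the `(k+1)`-th largest element of `S`. -/
def IsLargestAfter (k : ℕ) (S : Finset (Fin n)) (x : Fin n) : Prop :=
  x ∈ S ∧ (S.filter fun y => x < y).card = k

instance instDecidableIsLargestAfter (k : ℕ) (S : Finset (Fin n)) (x : Fin n) :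
    Decidable (IsLargestAfter k S x) :=
  inferInstanceAs (Decidable (x ∈ S ∧ (S.filter fun y => x < y).card = k))

/-- `x` is the `(k+1)`-th smallest element of `S`. -/
def IsSmallestAfter (k : ℕ) (S : Finset (Fin n)) (x : Fin n) : Prop :=
  x ∈ S ∧ (S.filter fun y => y < x).card = k

instance instDecidableIsSmallestAfter (k : ℕ) (S : Finset (Fin n)) (x : Fin n) :
    Decidable (IsSmallestAfter k S x) :=
  inferInstanceAs (Decidable (x ∈ S ∧ (S.filter fun y => y < x).card = k))

/-- `τ` is the output of the first construction on input `σ`. Let `F`, `F'` be the sets of descent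
bottoms and descent tops of `σ`, and `G`, `G'` their complements. The letters `j ∈ F` are processed
from the largest to the smallest, and `τ(j)` is the `((31-2)(j,σ)+1)`-th largest entry of `F'` that
is larger than `j` and not yet chosen; the letters `j ∈ G` are processed from the smallest to the
largest, and `τ(j)` is the `((31-2)(j,σ)+1)`-th smallest entry of `G'` that is not larger than `j`
and not yet chosen. -/
def IsOutput1 (σ τ : Equiv.Perm (Fin n)) : Prop :=
  (∀ j ∈ descentBottoms σ,
    IsLargestAfter (pat312 j σ)
      ((descentTops σ).filter fun x => j < x ∧ ∀ i ∈ descentBottoms σ, j < i → τ i ≠ x)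
      (τ j)) ∧
  (∀ j ∈ (descentBottoms σ)ᶜ,
    IsSmallestAfter (pat312 j σ)
      ((descentTops σ)ᶜ.filter fun x => x ≤ j ∧ ∀ i ∈ (descentBottoms σ)ᶜ, i < j → τ i ≠ x)
      (τ j))

instance instDecidableIsOutput1 (σ τ : Equiv.Perm (Fin n)) : Decidable (IsOutput1 σ τ) := by
  unfold IsOutput1; infer_instance

/-- `τ` is the output of the second construction on input `σ`. Let `F`, `F'` be the sets of descent
tops and descent bottoms of `σ`, and `G`, `G'` their complements. The letters `j ∈ F` are processed
from the smallest to the largest, and `τ(j)` is the `((31-2)(j,σ)+1)`-th largest entry of `F'` that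
is smaller than `j` and not yet chosen; the letters `j ∈ G` are processed from the largest to the
smallest, and `τ(j)` is the `((31-2)(j,σ)+1)`-th smallest entry of `G'` that is not smaller than `j`
and not yet chosen. -/
def IsOutputSZ (σ τ : Equiv.Perm (Fin n)) : Prop :=
  (∀ j ∈ descentTops σ,
    IsLargestAfter (pat312 j σ)
      ((descentBottoms σ).filter fun x => x < j ∧ ∀ i ∈ descentTops σ, i < j → τ i ≠ x)
      (τ j)) ∧
  (∀ j ∈ (descentTops σ)ᶜ,
    IsSmallestAfter (pat312 j σ)
      ((descentBottoms σ)ᶜ.filter fun x => j ≤ x ∧ ∀ i ∈ (descentTops σ)ᶜ, j < i → τ i ≠ x)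
      (τ j))

instance instDecidableIsOutputSZ (σ τ : Equiv.Perm (Fin n)) : Decidable (IsOutputSZ σ τ) := by
  unfold IsOutputSZ; infer_instance

/-- Reversal followed by complementation: `i ↦ n + 1 - τ(n + 1 - i)` on `[n]`. -/
def revCompl (τ : Equiv.Perm (Fin n)) : Equiv.Perm (Fin n) := Fin.revPerm * τ * Fin.revPerm

end PermStat

/-! Both maps are greedy matchings in which a letter `j` takes, among the admissible free values,
the one of rank (31-2)(j, σ). The descents counted by this number straddle `j`, which bounds it by a
difference between numbers of descent tops and bottoms on one side of `j`; hence the choice never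
runs out, and `existsUnique_perm_isGreedy` applies.

The output determines the input. Admissibility makes the descent tops and bottoms visible as sets of
positions and values where the output strictly rises (or falls, for the second map before reversal),
and the ranks of the choices return the 31-2 numbers. By `eq_of_descents_of_pat312` these data
determine σ, since the place of each letter among the smaller ones can be recovered. On a finite set
injectivity is enough.

For the statistics, `isRecord_iff` turns records into letters that are not descent bottoms and have
31-2 number zero. On the output side, rank zero means that the greedy choice is extremal, which
`IsOutput1.ear_iff`, `IsOutputSZ.pex_iff` and `IsOutputSZ.apply_eq_iff` translate into order
conditions. -/

namespace PermStat

/-! ### Greedy matchings with prescribed ranks. -/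

section Greedy

variable {α : Type*}

/-- In a finite set with a strict total order, elements are determined by their rank. -/
theorem rank_injOn (r : α → α → Prop) [DecidableRel r] [IsStrictTotalOrder α r] (S : Finset α) :
    Set.InjOn (fun x => (S.filter fun y => r x y).card) (S : Set α) := by
  have key : ∀ x ∈ S, ∀ y ∈ S, r x y →
      (S.filter fun z => r y z).card < (S.filter fun z => r x z).card := by
    intro x _ y hy hxy
    apply Finset.card_lt_card
    rw [Finset.ssubset_iff_of_subset]
    · exact ⟨y, by simp [hy, hxy], by simp [irrefl_of r y]⟩
    · intro z hz
      simp only [Finset.mem_filter] at hz ⊢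
      exact ⟨hz.1, trans_of r hxy hz.2⟩
  intro x hx y hy hxy
  rcases trichotomous_of r x y with h | h | h
  · exact absurd hxy (key x hx y hy h).ne'
  · exact h
  · exact absurd hxy (key y hy x hx h).ne

theorem exists_rank_eq (r : α → α → Prop) [DecidableRel r] [IsStrictTotalOrder α r]
    (S : Finset α) {k : ℕ} (hk : k < S.card) :
    ∃ x ∈ S, (S.filter fun y => r x y).card = k := by
  have himg : S.image (fun x => (S.filter fun y => r x y).card) = Finset.range S.card := by
    apply Finset.eq_of_subset_of_card_le
    · intro m hm
      obtain ⟨x, hx, rfl⟩ := Finset.mem_image.1 hm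
      rw [Finset.mem_range]
      apply Finset.card_lt_card
      rw [Finset.ssubset_iff_of_subset (Finset.filter_subset _ _)]
      exact ⟨x, hx, by simp [irrefl_of r x]⟩
    · rw [Finset.card_image_of_injOn (rank_injOn r S), Finset.card_range]
  have hk' : k ∈ S.image (fun x => (S.filter fun y => r x y).card) := by
    rw [himg]; exact Finset.mem_range.2 hk
  obtain ⟨x, hx, h⟩ := Finset.mem_image.1 hk'
  exact ⟨x, hx, h⟩

variable [DecidableEq α]

/-- The elements of `A'` which are admissible for `j` and not chosen by `f` at an earlier
element of `A`; here `P i j` says that `i` is processed before `j`. -/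
def available (A A' : Finset α) (P D : α → α → Prop) [DecidableRel P] [DecidableRel D]
    (f : α → α) (j : α) : Finset α :=
  A'.filter fun x => D j x ∧ ∀ i ∈ A, P i j → f i ≠ x

/-- On `A`, the function `f` chooses the available element of `r`-corank `k j`. -/
def IsGreedy (A A' : Finset α) (P D r : α → α → Prop) [DecidableRel P] [DecidableRel D]
    [DecidableRel r] (k : α → ℕ) (f : α → α) : Prop :=
  ∀ j ∈ A, f j ∈ available A A' P D f j ∧
    ((available A A' P D f j).filter fun y => r (f j) y).card = k j

variable {A A' : Finset α} {P D r : α → α → Prop} [DecidableRel P] [DecidableRel D]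
  [DecidableRel r] {k : α → ℕ} {f g : α → α}

theorem available_congr {j : α} (h : ∀ i ∈ A, P i j → f i = g i) :
    available A A' P D f j = available A A' P D g j := by
  apply Finset.filter_congr
  intro x _
  refine and_congr_right fun _ => forall_congr' fun i => forall_congr' fun hi =>
    forall_congr' fun hij => ?_
  rw [h i hi hij]

/-- Each earlier element of `A` uses up at most one admissible value. -/
theorem le_card_available (j : α) :
    (A'.filter fun x => D j x).card ≤
      (available A A' P D f j).card + (A.filter fun i => P i j).card := by
  have hsub : (A'.filter fun x => D j x) ⊆
      available A A' P D f j ∪ (A.filter fun i => P i j).image f := by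
    intro x hx
    simp only [available, Finset.mem_filter, Finset.mem_union, Finset.mem_image] at hx ⊢
    by_cases h : ∀ i ∈ A, P i j → f i ≠ x
    · exact Or.inl ⟨hx.1, hx.2, h⟩
    · push Not at h
      obtain ⟨i, hi, hij, hx'⟩ := h
      exact Or.inr ⟨i, ⟨hi, hij⟩, hx'⟩
  refine (Finset.card_le_card hsub).trans ((Finset.card_union_le _ _).trans ?_)
  exact Nat.add_le_add_left Finset.card_image_le _

/-- The bound `hk` leaves more than `k j` values at stage `j` whatever the earlier choices were, so
well-founded recursion along `P` never gets stuck. -/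
theorem exists_isGreedy (hP : WellFounded P) [IsStrictTotalOrder α r]
    (hk : ∀ j ∈ A, k j + (A.filter fun i => P i j).card < (A'.filter fun x => D j x).card) :
    ∃ f, IsGreedy A A' P D r k f := by
  classical
  -- The partial function `F` is padded by the identity; `available` only inspects elements
  -- processed before `j`, so the padding is never seen.
  let Q : (j : α) → ((i : α) → P i j → α) → α → Prop := fun j F x =>
    x ∈ available A A' P D (fun i => if h : P i j then F i h else i) j ∧
      ((available A A' P D (fun i => if h : P i j then F i h else i) j).filter
        fun y => r x y).card = k j
  let f : α → α := hP.fix fun j F => if h : ∃ x, Q j F x then h.choose else j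
  have hf : ∀ j, f j = if h : ∃ x, Q j (fun i _ => f i) x then h.choose else j :=
    fun j => hP.fix_eq _ j
  refine ⟨f, fun j hj => ?_⟩
  have hav : available A A' P D (fun i => if P i j then f i else i) j
      = available A A' P D f j :=
    available_congr fun i _ hij => if_pos hij
  have hex : ∃ x, Q j (fun i _ => f i) x := by
    simp only [Q, dite_eq_ite, hav]
    apply exists_rank_eq
    have h1 := hk j hj
    have h2 := le_card_available (A := A) (A' := A') (P := P) (D := D) (f := f) j
    omega
  have hspec := hex.choose_spec
  have hfj : f j = hex.choose := by rw [hf j, dif_pos hex]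
  rw [← hfj] at hspec
  simpa only [Q, dite_eq_ite, hav] using hspec

theorem IsGreedy.eqOn (hP : WellFounded P) [IsStrictTotalOrder α r]
    (hf : IsGreedy A A' P D r k f) (hg : IsGreedy A A' P D r k g) : ∀ j ∈ A, f j = g j := by
  intro j
  induction j using hP.induction with
  | _ j ih =>
    intro hj
    have hav : available A A' P D f j = available A A' P D g j :=
      available_congr fun i hi hij => ih i hij hi
    have h1 := hf j hj
    have h2 := hg j hj
    rw [← hav] at h2
    exact rank_injOn r _ h1.1 h2.1 (h1.2.trans h2.2.symm)

theorem IsGreedy.mem (hf : IsGreedy A A' P D r k f) {j : α} (hj : j ∈ A) : f j ∈ A' :=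
  (Finset.mem_filter.1 (hf j hj).1).1

theorem IsGreedy.rel (hf : IsGreedy A A' P D r k f) {j : α} (hj : j ∈ A) : D j (f j) :=
  (Finset.mem_filter.1 (hf j hj).1).2.1

theorem IsGreedy.injOn [IsStrictTotalOrder α P] (hf : IsGreedy A A' P D r k f) :
    Set.InjOn f (A : Set α) := by
  intro i hi j hj hij
  rcases trichotomous_of P i j with h | h | h
  · exact absurd hij ((Finset.mem_filter.1 (hf j hj).1).2.2 i hi h)
  · exact h
  · exact absurd hij.symm ((Finset.mem_filter.1 (hf i hi).1).2.2 j hj h)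

/-- The rank of a greedy choice can be read off from `f` alone. -/
theorem IsGreedy.rank_eq {k' : α → ℕ} (hf : IsGreedy A A' P D r k f)
    (hf' : IsGreedy A A' P D r k' f) {j : α} (hj : j ∈ A) : k j = k' j :=
  (hf j hj).2.symm.trans (hf' j hj).2

variable [Fintype α] {P₂ D₂ r₂ : α → α → Prop} [DecidableRel P₂] [DecidableRel D₂]
  [DecidableRel r₂]

/-- Two greedy constructions on complementary sets fit together to a unique permutation. -/
theorem existsUnique_perm_isGreedy
    (hP : WellFounded P) [IsStrictTotalOrder α P] [IsStrictTotalOrder α r]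
    (hP₂ : WellFounded P₂) [IsStrictTotalOrder α P₂] [IsStrictTotalOrder α r₂]
    (hk : ∀ j ∈ A, k j + (A.filter fun i => P i j).card < (A'.filter fun x => D j x).card)
    (hk₂ : ∀ j ∈ Aᶜ, k j + (Aᶜ.filter fun i => P₂ i j).card <
      (A'ᶜ.filter fun x => D₂ j x).card) :
    ∃! τ : Equiv.Perm α, IsGreedy A A' P D r k τ ∧ IsGreedy Aᶜ A'ᶜ P₂ D₂ r₂ k τ := by
  obtain ⟨f, hf⟩ := exists_isGreedy (r := r) hP hk
  obtain ⟨g, hg⟩ := exists_isGreedy (r := r₂) hP₂ hk₂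
  let t : α → α := fun j => if j ∈ A then f j else g j
  have htf : ∀ j ∈ A, t j = f j := fun j hj => if_pos hj
  have htg : ∀ j ∈ Aᶜ, t j = g j := fun j hj => if_neg (Finset.mem_compl.1 hj)
  have hf' : IsGreedy A A' P D r k t := by
    intro j hj
    rw [available_congr (g := f) fun i hi _ => htf i hi, htf j hj]
    exact hf j hj
  have hg' : IsGreedy Aᶜ A'ᶜ P₂ D₂ r₂ k t := by
    intro j hj
    rw [available_congr (g := g) fun i hi _ => htg i hi, htg j hj]
    exact hg j hj
  -- Collisions within a block are excluded by the greedy rule, and collisions between blocks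
  -- because the values lie in complementary sets.
  have hinj : Function.Injective t := by
    intro i j hij
    by_cases hi : i ∈ A <;> by_cases hj : j ∈ A
    · exact hf'.injOn hi hj hij
    · exact absurd (hij ▸ hf'.mem hi) (Finset.mem_compl.1 (hg'.mem (Finset.mem_compl.2 hj)))
    · exact absurd (hij ▸ hf'.mem hj) (Finset.mem_compl.1 (hg'.mem (Finset.mem_compl.2 hi)))
    · exact hg'.injOn (by simpa using hi) (by simpa using hj) hij
  refine ⟨Equiv.ofBijective t (Finite.injective_iff_bijective.1 hinj), ⟨hf', hg'⟩, ?_⟩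
  rintro τ ⟨h1, h2⟩
  ext j
  by_cases hj : j ∈ A
  · exact h1.eqOn hP hf' j hj
  · exact h2.eqOn hP₂ hg' j (Finset.mem_compl.2 hj)

end Greedy

end PermStat

/-! ### Descents as pairs of adjacent positions. -/

namespace PermStat

variable {n : ℕ}

theorem inv_apply_self (σ : Equiv.Perm (Fin n)) (x : Fin n) : σ⁻¹ (σ x) = x :=
  σ.symm_apply_apply x

/-- The descents of `σ`, as pairs of adjacent positions. -/
def descentPairs (σ : Equiv.Perm (Fin n)) : Finset (Fin n × Fin n) :=
  Finset.univ.filter fun e => Next e.1 e.2 ∧ σ e.2 < σ e.1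

theorem mem_descentPairs {σ : Equiv.Perm (Fin n)} {e : Fin n × Fin n} :
    e ∈ descentPairs σ ↔ Next e.1 e.2 ∧ σ e.2 < σ e.1 := by
  simp [descentPairs]

theorem Next.left_unique {i i' j : Fin n} (h : Next i j) (h' : Next i' j) : i = i' := by
  unfold Next at h h'; omega

theorem Next.right_unique {i j j' : Fin n} (h : Next i j) (h' : Next i j') : j = j' := by
  unfold Next at h h'; omega

theorem mem_descentTops {σ : Equiv.Perm (Fin n)} {x : Fin n} :
    x ∈ descentTops σ ↔ ∃ e ∈ descentPairs σ, σ e.1 = x := by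
  simp [descentTops, mem_descentPairs, and_assoc]

theorem mem_descentBottoms {σ : Equiv.Perm (Fin n)} {x : Fin n} :
    x ∈ descentBottoms σ ↔ ∃ e ∈ descentPairs σ, σ e.2 = x := by
  simp [descentBottoms, mem_descentPairs, and_assoc]

/-- A descent is determined by its top, and likewise by its bottom, so tops, bottoms and 31-2
occurrences can all be counted inside the single set `descentPairs σ`. -/
theorem card_filter_descentTops (σ : Equiv.Perm (Fin n)) (p : Fin n → Prop) [DecidablePred p] :
    ((descentTops σ).filter p).card = ((descentPairs σ).filter fun e => p (σ e.1)).card := by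
  symm
  apply Finset.card_bij (fun e _ => σ e.1)
  · intro e he
    rw [Finset.mem_filter] at he ⊢
    exact ⟨mem_descentTops.2 ⟨e, he.1, rfl⟩, he.2⟩
  · rintro ⟨a, b⟩ he ⟨c, d⟩ he' h
    obtain rfl : a = c := σ.injective h
    have h1 := (mem_descentPairs.1 (Finset.mem_filter.1 he).1).1
    have h2 := (mem_descentPairs.1 (Finset.mem_filter.1 he').1).1
    obtain rfl : b = d := h1.right_unique h2
    rfl
  · intro x hx
    rw [Finset.mem_filter] at hx
    obtain ⟨e, he, rfl⟩ := mem_descentTops.1 hx.1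
    exact ⟨e, Finset.mem_filter.2 ⟨he, hx.2⟩, rfl⟩

theorem card_filter_descentBottoms (σ : Equiv.Perm (Fin n)) (p : Fin n → Prop)
    [DecidablePred p] :
    ((descentBottoms σ).filter p).card = ((descentPairs σ).filter fun e => p (σ e.2)).card := by
  symm
  apply Finset.card_bij (fun e _ => σ e.2)
  · intro e he
    rw [Finset.mem_filter] at he ⊢
    exact ⟨mem_descentBottoms.2 ⟨e, he.1, rfl⟩, he.2⟩
  · rintro ⟨a, b⟩ he ⟨c, d⟩ he' h
    obtain rfl : b = d := σ.injective h
    have h1 := (mem_descentPairs.1 (Finset.mem_filter.1 he).1).1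
    have h2 := (mem_descentPairs.1 (Finset.mem_filter.1 he').1).1
    obtain rfl : a = c := h1.left_unique h2
    rfl
  · intro x hx
    rw [Finset.mem_filter] at hx
    obtain ⟨e, he, rfl⟩ := mem_descentBottoms.1 hx.1
    exact ⟨e, Finset.mem_filter.2 ⟨he, hx.2⟩, rfl⟩

theorem pat312_eq_card (x : Fin n) (σ : Equiv.Perm (Fin n)) :
    pat312 x σ = ((descentPairs σ).filter fun e =>
      e.2 < σ⁻¹ x ∧ σ e.2 < x ∧ x < σ e.1).card := by
  symm
  apply Finset.card_bij (fun e _ => e.2)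
  · intro e he
    rw [Finset.mem_filter] at he
    simp only [Finset.mem_filter, Finset.mem_univ, true_and]
    exact ⟨e.1, (mem_descentPairs.1 he.1).1, he.2⟩
  · rintro ⟨a, b⟩ he ⟨c, d⟩ he' h
    obtain rfl : b = d := h
    have h1 := (mem_descentPairs.1 (Finset.mem_filter.1 he).1).1
    have h2 := (mem_descentPairs.1 (Finset.mem_filter.1 he').1).1
    obtain rfl : a = c := h1.left_unique h2
    rfl
  · intro q hq
    simp only [Finset.mem_filter, Finset.mem_univ, true_and] at hq
    obtain ⟨p, hp, h⟩ := hq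
    exact ⟨(p, q), Finset.mem_filter.2 ⟨mem_descentPairs.2 ⟨hp, h.2.1.trans h.2.2⟩, h⟩, rfl⟩

theorem card_descentTops (σ : Equiv.Perm (Fin n)) : (descentTops σ).card = des σ := by
  symm
  apply Finset.card_bij (fun i _ => σ i)
  · intro i hi
    obtain ⟨j, hj⟩ := (Finset.mem_filter.1 hi).2
    exact mem_descentTops.2 ⟨(i, j), mem_descentPairs.2 hj, rfl⟩
  · intro i _ j _ h
    exact σ.injective h
  · intro x hx
    obtain ⟨e, he, rfl⟩ := mem_descentTops.1 hx
    exact ⟨e.1, Finset.mem_filter.2 ⟨Finset.mem_univ _, e.2, mem_descentPairs.1 he⟩, rfl⟩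

theorem card_descentBottoms (σ : Equiv.Perm (Fin n)) : (descentBottoms σ).card = des σ := by
  rw [← card_descentTops]
  simpa using (card_filter_descentBottoms σ fun _ => True).trans
    (card_filter_descentTops σ fun _ => True).symm

/-! ### Enough values remain for every choice. -/

section Counting

variable {σ : Equiv.Perm (Fin n)} {j : Fin n}

/-- Descents straddling `j` and descents with bottom at least `j` are disjoint families, and both
have their tops above `j`. -/
theorem pat312_add_card_bottoms_le (σ : Equiv.Perm (Fin n)) (j : Fin n) :
    pat312 j σ + ((descentBottoms σ).filter fun i => j ≤ i).card ≤
      ((descentTops σ).filter fun x => j < x).card := by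
  rw [card_filter_descentBottoms, card_filter_descentTops, pat312_eq_card,
    ← Finset.card_union_of_disjoint]
  · apply Finset.card_le_card
    intro e he
    simp only [Finset.mem_union, Finset.mem_filter, mem_descentPairs] at he ⊢
    rcases he with he | he
    · exact ⟨he.1, he.2.2.2⟩
    · exact ⟨he.1, he.2.trans_lt he.1.2⟩
  · rw [Finset.disjoint_left]
    intro e he he'
    simp only [Finset.mem_filter] at he he'
    exact absurd he.2.2.1 he'.2.not_gt

theorem pat312_add_card_tops_le (σ : Equiv.Perm (Fin n)) (j : Fin n) :
    pat312 j σ + ((descentTops σ).filter fun i => i ≤ j).card ≤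
      ((descentBottoms σ).filter fun x => x < j).card := by
  rw [card_filter_descentBottoms, card_filter_descentTops, pat312_eq_card,
    ← Finset.card_union_of_disjoint]
  · apply Finset.card_le_card
    intro e he
    simp only [Finset.mem_union, Finset.mem_filter, mem_descentPairs] at he ⊢
    rcases he with he | he
    · exact ⟨he.1, he.2.2.1⟩
    · exact ⟨he.1, he.1.2.trans_le he.2⟩
  · rw [Finset.disjoint_left]
    intro e he he'
    simp only [Finset.mem_filter] at he he'
    exact absurd he.2.2.2 he'.2.not_gt

theorem card_filter_lt_of_mem {α : Type*} {s : Finset α} {p q : α → Prop} [DecidablePred p]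
    [DecidablePred q] (hpq : ∀ x, p x → q x) {a : α} (ha : a ∈ s) (hq : q a) (hp : ¬ p a) :
    (s.filter p).card < (s.filter q).card := by
  apply Finset.card_lt_card
  rw [Finset.ssubset_iff_of_subset (Finset.monotone_filter_right s fun x _ => hpq x)]
  exact ⟨a, by simp [ha, hq], by simp [hp]⟩

theorem lt_card_available_of_mem_bottoms (hj : j ∈ descentBottoms σ) :
    pat312 j σ + ((descentBottoms σ).filter fun i => j < i).card <
      ((descentTops σ).filter fun x => j < x).card := by
  have h1 := pat312_add_card_bottoms_le σ j
  have h2 := card_filter_lt_of_mem (p := fun i => j < i) (q := fun i => j ≤ i)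
    (fun _ => le_of_lt) hj le_rfl (lt_irrefl j)
  omega

theorem lt_card_available_of_mem_tops (hj : j ∈ descentTops σ) :
    pat312 j σ + ((descentTops σ).filter fun i => i < j).card <
      ((descentBottoms σ).filter fun x => x < j).card := by
  have h1 := pat312_add_card_tops_le σ j
  have h2 := card_filter_lt_of_mem (p := fun i => i < j) (q := fun i => i ≤ j)
    (fun _ => le_of_lt) hj le_rfl (lt_irrefl j)
  omega

theorem card_filter_add_compl (s : Finset (Fin n)) (p : Fin n → Prop) [DecidablePred p] :
    (s.filter p).card + (sᶜ.filter p).card = (Finset.univ.filter p).card := by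
  rw [← Finset.card_union_of_disjoint, ← Finset.filter_union, Finset.union_compl]
  exact Finset.disjoint_filter_filter disjoint_compl_right

/-- Passing to complements reverses the inequality between tops and bottoms; strictness comes from
`j` itself, which separates `i < j` from `i ≤ j`. -/
theorem lt_card_available_compl_bottoms (σ : Equiv.Perm (Fin n)) (j : Fin n) :
    pat312 j σ + ((descentBottoms σ)ᶜ.filter fun i => i < j).card <
      ((descentTops σ)ᶜ.filter fun x => x ≤ j).card := by
  have h1 := pat312_add_card_tops_le σ j
  have h2 := card_filter_add_compl (descentBottoms σ) fun i => i < j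
  have h3 := card_filter_add_compl (descentTops σ) fun i => i ≤ j
  have h4 := card_filter_lt_of_mem (p := fun i => i < j) (q := fun i => i ≤ j)
    (fun _ => le_of_lt) (Finset.mem_univ j) le_rfl (lt_irrefl j)
  omega

theorem lt_card_available_compl_tops (σ : Equiv.Perm (Fin n)) (j : Fin n) :
    pat312 j σ + ((descentTops σ)ᶜ.filter fun i => j < i).card <
      ((descentBottoms σ)ᶜ.filter fun x => j ≤ x).card := by
  have h1 := pat312_add_card_bottoms_le σ j
  have h2 := card_filter_add_compl (descentTops σ) fun i => j < i
  have h3 := card_filter_add_compl (descentBottoms σ) fun i => j ≤ i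
  have h4 := card_filter_lt_of_mem (p := fun i => j < i) (q := fun i => j ≤ i)
    (fun _ => le_of_lt) (Finset.mem_univ j) le_rfl (lt_irrefl j)
  omega

end Counting

/-! ### Records and reconstruction of a permutation from its 31-2 numbers. -/

/-- A property of positions that holds at `a` and fails at a later `b` is lost at some step. -/
theorem exists_next_of_not {p : Fin n → Prop} {a b : Fin n} (hab : a < b) (ha : p a)
    (hb : ¬ p b) : ∃ i j, Next i j ∧ a ≤ i ∧ j ≤ b ∧ p i ∧ ¬ p j := by
  by_contra! hno
  have : ∀ m (hm : m < n), (a : ℕ) ≤ m → m ≤ b → p ⟨m, hm⟩ := by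
    intro m
    induction m with
    | zero =>
      intro hm h _
      rwa [show (⟨0, hm⟩ : Fin n) = a from Fin.ext (by simp; omega)]
    | succ m ih =>
      intro hm h1 h2
      rcases h1.eq_or_lt with h | h
      · rwa [show (⟨m + 1, hm⟩ : Fin n) = a from Fin.ext h.symm]
      · exact hno ⟨m, by omega⟩ ⟨m + 1, hm⟩ rfl (Fin.le_def.2 (by simp; omega))
          (Fin.le_def.2 h2) (ih (by omega) (by omega) (by omega))
  exact hb (this b b.2 (Fin.le_def.1 hab.le) le_rfl)

/-- A letter which is not a descent bottom is a record if and only if it is the `2` of no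
occurrence of `31-2`. -/
theorem isRecord_iff {σ : Equiv.Perm (Fin n)} {i : Fin n} :
    IsRecord σ i ↔ σ i ∉ descentBottoms σ ∧ pat312 (σ i) σ = 0 := by
  constructor
  · intro h
    constructor
    · intro hb
      obtain ⟨⟨k, q⟩, he, hq⟩ := mem_descentBottoms.1 hb
      rw [mem_descentPairs] at he
      obtain rfl : q = i := σ.injective hq
      have hk : k < q := Fin.lt_def.2 (by have := he.1; simp only [Next] at this; omega)
      exact absurd he.2 (h k hk).not_gt
    · rw [pat312, Finset.card_eq_zero, Finset.filter_eq_empty_iff]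
      rintro q - ⟨k, hk, hq, -, hlt⟩
      rw [inv_apply_self] at hq
      exact absurd hlt (h k (lt_trans (Fin.lt_def.2 (by unfold Next at hk; omega)) hq)).not_gt
  · rintro ⟨hb, hp⟩ j hji
    by_contra hlt
    have hlt' : σ i < σ j :=
      lt_of_le_of_ne (not_lt.1 hlt) fun h => hji.ne' (σ.injective h)
    -- Walking from the larger letter at `j` to position `i`, some step drops from above `σ i` to at
    -- most `σ i`. It either ends at `i`, making `σ i` a descent bottom, or gives a 31-2 occurrence.
    obtain ⟨k, q, hkq, -, hq, hk, hqn⟩ :=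
      exists_next_of_not (p := fun m => σ i < σ m) hji hlt' (lt_irrefl _)
    have hne : q ≠ i := by
      rintro rfl
      exact hb (mem_descentBottoms.2 ⟨(k, q), mem_descentPairs.2 ⟨hkq, hk⟩, rfl⟩)
    rw [pat312, Finset.card_eq_zero, Finset.filter_eq_empty_iff] at hp
    refine hp (Finset.mem_univ q) ⟨k, hkq, ?_, ?_, hk⟩
    · rw [inv_apply_self]; exact lt_of_le_of_ne hq hne
    · exact lt_of_le_of_ne (not_lt.1 hqn) fun h => hne (σ.injective h)

/-- Whether a smaller letter `y` stands to the left of `x` is decided by the relative order of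
the letters smaller than `x`, the descent tops and bottoms, and the `31-2` number of `x`. -/
theorem inv_lt_inv_iff (σ : Equiv.Perm (Fin n)) {x y : Fin n} (hyx : y < x) :
    σ⁻¹ y < σ⁻¹ x ↔
      ((descentBottoms σ).filter fun b => b < x ∧ σ⁻¹ b ≤ σ⁻¹ y).card ≤
        ((descentTops σ).filter fun t => t < x ∧ σ⁻¹ t < σ⁻¹ y).card + pat312 x σ := by
  rw [card_filter_descentTops, card_filter_descentBottoms, pat312_eq_card]
  simp only [inv_apply_self]
  -- Descents with bottom below `x`, up to the position of `y`, either have their top below `x` too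
  -- or straddle `x`. Cancelling the first kind leaves a comparison of straddling descents before
  -- `y` and before `x`.
  have hsplit : ((descentPairs σ).filter fun e => σ e.2 < x ∧ e.2 ≤ σ⁻¹ y).card =
      ((descentPairs σ).filter fun e => σ e.1 < x ∧ e.1 < σ⁻¹ y).card +
      ((descentPairs σ).filter fun e => e.2 ≤ σ⁻¹ y ∧ σ e.2 < x ∧ x ≤ σ e.1).card := by
    rw [← Finset.card_union_of_disjoint]
    · congr 1
      ext e
      simp only [Finset.mem_union, Finset.mem_filter, mem_descentPairs, Next, Fin.le_def,
        Fin.lt_def]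
      omega
    · rw [Finset.disjoint_left]
      intro e he he'
      simp only [Finset.mem_filter] at he he'
      exact absurd he.2.1 he'.2.2.2.not_gt
  have hpat : ((descentPairs σ).filter fun e => e.2 < σ⁻¹ x ∧ σ e.2 < x ∧ x < σ e.1) =
      ((descentPairs σ).filter fun e => e.2 ≤ σ⁻¹ x ∧ σ e.2 < x ∧ x ≤ σ e.1) := by
    ext ⟨k, q⟩
    simp only [Finset.mem_filter, mem_descentPairs]
    constructor
    · rintro ⟨h, h1, h2, h3⟩
      exact ⟨h, h1.le, h2, h3.le⟩
    · rintro ⟨h, h1, h2, h3⟩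
      have hq : q ≠ σ⁻¹ x := by rintro rfl; simp at h2
      have hk : x ≠ σ k := by
        rintro rfl
        rw [inv_apply_self, Fin.le_def] at h1
        have := h.1
        simp only [Next] at this
        omega
      exact ⟨h, lt_of_le_of_ne h1 hq, h2, lt_of_le_of_ne h3 hk⟩
  rw [hsplit, hpat, Nat.add_le_add_iff_left]
  constructor
  · intro h
    apply Finset.card_le_card
    apply Finset.monotone_filter_right
    exact fun e _ he => ⟨he.1.trans h.le, he.2⟩
  · intro h
    by_contra hlt
    have hlt' : σ⁻¹ x < σ⁻¹ y :=
      lt_of_le_of_ne (not_lt.1 hlt) fun h => hyx.ne' (σ⁻¹.injective h)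
    -- If `x` precedes `y`, the walk from `x` down to `y` contains a descent straddling `x` that is
    -- counted for `y` but not for `x`.
    obtain ⟨k, q, hkq, hk', hq', hk, hq⟩ := exists_next_of_not (p := fun m => x ≤ σ m) hlt'
      (by simp) (by simpa using hyx)
    rw [not_le] at hq
    refine absurd h (not_le.2 (card_filter_lt_of_mem (a := (k, q)) ?_ ?_ ?_ ?_))
    · exact fun e he => ⟨he.1.trans hlt'.le, he.2⟩
    · exact mem_descentPairs.2 ⟨hkq, hq.trans_le hk⟩
    · exact ⟨hq', hq, hk⟩
    · rintro ⟨hc, -⟩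
      unfold Next at hkq
      rw [Fin.le_def] at hc hk'
      simp only at hc
      omega

/-- A permutation is determined by its descent tops, its descent bottoms and its `31-2`
numbers. -/
theorem eq_of_descents_of_pat312 {σ σ' : Equiv.Perm (Fin n)}
    (hT : descentTops σ = descentTops σ') (hB : descentBottoms σ = descentBottoms σ')
    (hp : ∀ x, pat312 x σ = pat312 x σ') : σ = σ' := by
  -- Induction on the larger letter: both counts in `inv_lt_inv_iff` involve only the relative order
  -- of letters below `x`.
  have key : ∀ x y, y < x → (σ⁻¹ y < σ⁻¹ x ↔ σ'⁻¹ y < σ'⁻¹ x) := by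
    intro x
    induction x using WellFoundedLT.induction with
    | _ x ih =>
      have ih' : ∀ a b, a < x → b < x → (σ⁻¹ a < σ⁻¹ b ↔ σ'⁻¹ a < σ'⁻¹ b) := by
        intro a b ha hb
        rcases lt_trichotomy a b with h | rfl | h
        · exact ih b hb a h
        · simp
        · have h1 := ih a ha b h
          have h2 : σ⁻¹ a ≠ σ⁻¹ b := fun h' => h.ne' (σ⁻¹.injective h')
          have h3 : σ'⁻¹ a ≠ σ'⁻¹ b := fun h' => h.ne' (σ'⁻¹.injective h')
          rw [← not_iff_not, not_lt, not_lt, h2.symm.le_iff_lt, h3.symm.le_iff_lt]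
          exact h1
      intro y hy
      rw [inv_lt_inv_iff σ hy, inv_lt_inv_iff σ' hy, hT, hB, hp x]
      have e1 : ((descentBottoms σ').filter fun b => b < x ∧ σ⁻¹ b ≤ σ⁻¹ y) =
          ((descentBottoms σ').filter fun b => b < x ∧ σ'⁻¹ b ≤ σ'⁻¹ y) := by
        apply Finset.filter_congr
        intro b _
        refine and_congr_right fun hb => ?_
        rw [← not_lt, ← not_lt, ih' y b hy hb]
      have e2 : ((descentTops σ').filter fun t => t < x ∧ σ⁻¹ t < σ⁻¹ y) =
          ((descentTops σ').filter fun t => t < x ∧ σ'⁻¹ t < σ'⁻¹ y) := by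
        apply Finset.filter_congr
        intro b _
        exact and_congr_right fun hb => ih' b y hb hy
      rw [e1, e2]
  -- The same relative order of positions makes `σ'⁻¹ ∘ σ` an increasing bijection, hence the
  -- identity.
  have hmono : StrictMono (fun i => σ'⁻¹ (σ i)) := by
    intro i j hij
    have hne : σ i ≠ σ j := fun h => hij.ne (σ.injective h)
    rcases lt_or_gt_of_ne hne with h | h
    · exact (key _ _ h).1 (by simpa using hij)
    · have := (key _ _ h).not.1 (by simpa using hij.le)
      exact lt_of_le_of_ne (not_lt.1 this) fun h' => hne (σ'⁻¹.injective h')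
  have hid : (fun i => σ'⁻¹ (σ i)) = id :=
    (hmono.range_inj strictMono_id).1
      (by rw [Set.range_id]; exact ((σ'⁻¹).surjective.comp σ.surjective).range_eq)
  ext i
  have := congrFun hid i
  simp only [id] at this
  rw [Equiv.Perm.inv_eq_iff_eq] at this
  rw [this]

end PermStat

/-! ### The two constructions as greedy matchings. -/

namespace PermStat

variable {n : ℕ} {σ τ : Equiv.Perm (Fin n)}

/-- The three relations are processing order, admissibility and ranking; ranking by `<` counts
larger values and so selects from the top, ranking by `>` from the bottom. -/
theorem isOutput1_iff : IsOutput1 σ τ ↔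
    IsGreedy (descentBottoms σ) (descentTops σ) (· > ·) (· < ·) (· < ·) (pat312 · σ) τ ∧
    IsGreedy (descentBottoms σ)ᶜ (descentTops σ)ᶜ (· < ·) (· ≥ ·) (· > ·) (pat312 · σ) τ := by
  simp only [IsOutput1, IsGreedy, IsLargestAfter, IsSmallestAfter, available]

theorem isOutputSZ_iff : IsOutputSZ σ τ ↔
    IsGreedy (descentTops σ) (descentBottoms σ) (· < ·) (· > ·) (· < ·) (pat312 · σ) τ ∧
    IsGreedy (descentTops σ)ᶜ (descentBottoms σ)ᶜ (· > ·) (· ≤ ·) (· > ·) (pat312 · σ) τ := by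
  simp only [IsOutputSZ, IsGreedy, IsLargestAfter, IsSmallestAfter, available]

theorem existsUnique_isOutput1 (σ : Equiv.Perm (Fin n)) : ∃! τ, IsOutput1 σ τ := by
  simp only [isOutput1_iff]
  exact existsUnique_perm_isGreedy wellFounded_gt wellFounded_lt
    (fun j hj => lt_card_available_of_mem_bottoms hj)
    (fun j _ => lt_card_available_compl_bottoms σ j)

theorem existsUnique_isOutputSZ (σ : Equiv.Perm (Fin n)) : ∃! τ, IsOutputSZ σ τ := by
  simp only [isOutputSZ_iff]
  exact existsUnique_perm_isGreedy wellFounded_lt wellFounded_gt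
    (fun j hj => lt_card_available_of_mem_tops hj)
    (fun j _ => lt_card_available_compl_tops σ j)

/-- Greedy constructions on complementary sets map exactly `A` into `A'`. -/
theorem apply_mem_iff_of_isGreedy {α : Type*} [DecidableEq α] [Fintype α] {A A' : Finset α}
    {P D r P₂ D₂ r₂ : α → α → Prop} [DecidableRel P] [DecidableRel D] [DecidableRel r]
    [DecidableRel P₂] [DecidableRel D₂] [DecidableRel r₂] {k : α → ℕ} {f : α → α}
    (h : IsGreedy A A' P D r k f) (h₂ : IsGreedy Aᶜ A'ᶜ P₂ D₂ r₂ k f) {j : α} :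
    f j ∈ A' ↔ j ∈ A := by
  refine ⟨fun hj => ?_, h.mem⟩
  by_contra hA
  exact Finset.mem_compl.1 (h₂.mem (Finset.mem_compl.2 hA)) hj

theorem IsGreedy.eq_zero_iff {α : Type*} [DecidableEq α] {A A' : Finset α}
    {P D r : α → α → Prop} [DecidableRel P] [DecidableRel D] [DecidableRel r] {k : α → ℕ}
    {f : α → α} (h : IsGreedy A A' P D r k f) {j : α} (hj : j ∈ A) :
    k j = 0 ↔ ∀ y ∈ A', D j y → (∀ i ∈ A, P i j → f i ≠ y) → ¬ r (f j) y := by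
  rw [← (h j hj).2, Finset.card_eq_zero, Finset.filter_eq_empty_iff]
  simp only [available, Finset.mem_filter, and_imp]

/-! ### The first map: excedances and exclusive antirecord cycle peaks. -/

section FirstMap

theorem IsOutput1.apply_mem_descentTops_iff (h : IsOutput1 σ τ) {j : Fin n} :
    τ j ∈ descentTops σ ↔ j ∈ descentBottoms σ :=
  apply_mem_iff_of_isGreedy (isOutput1_iff.1 h).1 (isOutput1_iff.1 h).2

/-- The admissibility conditions of the two blocks exclude each other, so the descent bottoms can be
read off from `τ`. -/
theorem IsOutput1.lt_apply_iff (h : IsOutput1 σ τ) {j : Fin n} :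
    j < τ j ↔ j ∈ descentBottoms σ := by
  refine ⟨fun hj => ?_, fun hj => (isOutput1_iff.1 h).1.rel hj⟩
  by_contra hB
  exact absurd hj (not_lt.2 ((isOutput1_iff.1 h).2.rel (Finset.mem_compl.2 hB)))

theorem IsOutput1.inv_lt_iff (h : IsOutput1 σ τ) {x : Fin n} :
    τ⁻¹ x < x ↔ x ∈ descentTops σ := by
  have hx : τ (τ⁻¹ x) = x := τ.apply_symm_apply x
  have h1 := h.lt_apply_iff (j := τ⁻¹ x)
  rwa [← h.apply_mem_descentTops_iff, hx] at h1

theorem IsOutput1.des_eq_exc (h : IsOutput1 σ τ) : des σ = exc τ := by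
  rw [← card_descentBottoms, exc]
  congr 1
  ext j
  simp [h.lt_apply_iff]

/-- For `i` not a descent bottom, a smaller free value at stage `i` is exactly a smaller value of
`τ` to the right of `i`: it is taken later, and descent bottoms to the right of `i` only take values
above `i`. So rank zero means antirecord. -/
theorem IsOutput1.ear_iff (h : IsOutput1 σ τ) {i : Fin n} :
    (IsAntirecord τ i ∧ ¬ IsRecord τ i) ∧ IsCyclePeak τ i ↔
      i ∈ descentTops σ ∧ i ∉ descentBottoms σ ∧ pat312 i σ = 0 := by
  have hg := (isOutput1_iff.1 h).2
  have hanti : i ∉ descentBottoms σ → (IsAntirecord τ i ↔ pat312 i σ = 0) := by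
    intro hi
    rw [hg.eq_zero_iff (Finset.mem_compl.2 hi)]
    constructor
    · intro ha y hy hyi hch hlt
      have hτy : τ (τ⁻¹ y) = y := τ.apply_symm_apply y
      have hmem : τ⁻¹ y ∉ descentBottoms σ := by
        rw [← h.apply_mem_descentTops_iff, hτy]
        exact Finset.mem_compl.1 hy
      have hle : i ≤ τ⁻¹ y :=
        not_lt.1 fun hlt' => hch _ (Finset.mem_compl.2 hmem) hlt' hτy
      rcases hle.eq_or_lt with heq | hlt'
      · rw [heq, hτy] at hlt
        exact lt_irrefl _ hlt
      · have := ha _ hlt'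
        rw [hτy] at this
        exact absurd this (not_lt.2 (le_of_lt hlt))
    · intro hz j hij
      have hii : τ i ≤ i := hg.rel (Finset.mem_compl.2 hi)
      by_cases hj : j ∈ descentBottoms σ
      · exact hii.trans_lt (hij.trans (h.lt_apply_iff.2 hj))
      · by_contra hlt
        have hlt' : τ j < τ i :=
          lt_of_le_of_ne (not_lt.1 hlt) fun h' => hij.ne' (τ.injective h')
        refine hz (τ j) (hg.mem (Finset.mem_compl.2 hj)) (hlt'.le.trans hii) ?_ hlt'
        intro m _ hm heq
        exact absurd (hm.trans hij) (τ.injective heq ▸ lt_irrefl m)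
  constructor
  · rintro ⟨⟨ha, -⟩, hc1, hc2⟩
    have hi : i ∉ descentBottoms σ := fun hi => absurd (h.lt_apply_iff.2 hi) hc2.not_gt
    exact ⟨h.inv_lt_iff.1 hc1, hi, (hanti hi).1 ha⟩
  · rintro ⟨hT, hB, hp⟩
    have hc1 := h.inv_lt_iff.2 hT
    have hle : τ i ≤ i := hg.rel (Finset.mem_compl.2 hB)
    -- A cycle peak is never a record, since the value `i ≥ τ i` occurs before position `i`. A fixed
    -- point is impossible, since a descent top is the image of a descent bottom.
    refine ⟨⟨(hanti hB).2 hp, fun hr => ?_⟩, hc1, lt_of_le_of_ne hle fun heq => ?_⟩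
    · have h1 := hr _ hc1
      rw [show τ (τ⁻¹ i) = i from τ.apply_symm_apply i] at h1
      exact absurd h1 hle.not_gt
    · exact hB (h.apply_mem_descentTops_iff.1 (by rwa [heq]))

end FirstMap

/-! ### Statistics of the input in terms of its letters; injectivity of the first map. -/

theorem isDescent_iff {i : Fin n} : IsDescent σ i ↔ σ i ∈ descentTops σ := by
  rw [mem_descentTops]
  constructor
  · rintro ⟨j, hj⟩
    exact ⟨(i, j), mem_descentPairs.2 hj, rfl⟩
  · rintro ⟨e, he, hei⟩
    rw [← σ.injective hei]
    exact ⟨e.2, mem_descentPairs.1 he⟩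

theorem des2_eq_card (σ : Equiv.Perm (Fin n)) :
    des2 σ = (Finset.univ.filter fun x =>
      x ∈ descentTops σ ∧ x ∉ descentBottoms σ ∧ pat312 x σ = 0).card := by
  refine Finset.card_equiv σ fun i => ?_
  simp only [Finset.mem_filter, Finset.mem_univ, true_and]
  exact and_congr isDescent_iff isRecord_iff

theorem isDoubleAscent_iff {i : Fin n} :
    IsDoubleAscent σ i ↔ σ i ∉ descentBottoms σ ∧ σ i ∉ descentTops σ := by
  rw [mem_descentTops, mem_descentBottoms]
  constructor
  · rintro ⟨h1, h2⟩
    constructor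
    · rintro ⟨e, he, hei⟩
      rw [mem_descentPairs, σ.injective hei] at he
      exact absurd he.2 (h1 _ he.1).not_gt
    · rintro ⟨e, he, hei⟩
      rw [mem_descentPairs, σ.injective hei] at he
      exact absurd he.2 (h2 _ he.1).not_gt
  · have hne : ∀ a b, Next a b → σ a ≠ σ b := by
      intro a b hab h
      rw [σ.injective h] at hab
      simp only [Next] at hab
      omega
    rintro ⟨h1, h2⟩
    constructor
    · intro k hk
      by_contra hlt
      exact h1 ⟨(k, i), mem_descentPairs.2 ⟨hk, lt_of_le_of_ne (not_lt.1 hlt) (hne k i hk).symm⟩,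
        rfl⟩
    · intro k hk
      by_contra hlt
      exact h2 ⟨(i, k), mem_descentPairs.2 ⟨hk, lt_of_le_of_ne (not_lt.1 hlt) (hne i k hk).symm⟩,
        rfl⟩

theorem fmax_eq_card (σ : Equiv.Perm (Fin n)) :
    fmax σ = (Finset.univ.filter fun x =>
      x ∉ descentTops σ ∧ x ∉ descentBottoms σ ∧ pat312 x σ = 0).card := by
  refine Finset.card_equiv σ fun i => ?_
  simp only [Finset.mem_filter, Finset.mem_univ, true_and, isDoubleAscent_iff, isRecord_iff]
  tauto

theorem IsOutput1.des2_eq_ear (h : IsOutput1 σ τ) : des2 σ = ear τ := by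
  rw [des2_eq_card, ear]
  congr 1
  ext i
  simp only [Finset.mem_filter, Finset.mem_univ, true_and, h.ear_iff]

theorem IsOutput1.injective {σ' : Equiv.Perm (Fin n)} (h : IsOutput1 σ τ)
    (h' : IsOutput1 σ' τ) : σ = σ' := by
  have hT : descentTops σ = descentTops σ' := by
    ext x; rw [← h.inv_lt_iff, h'.inv_lt_iff]
  have hB : descentBottoms σ = descentBottoms σ' := by
    ext x; rw [← h.lt_apply_iff, h'.lt_apply_iff]
  refine eq_of_descents_of_pat312 hT hB fun x => ?_
  rw [isOutput1_iff] at h h'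
  rw [← hT, ← hB] at h'
  by_cases hx : x ∈ descentBottoms σ
  · exact h.1.rank_eq h'.1 hx
  · exact h.2.rank_eq h'.2 (Finset.mem_compl.2 hx)

/-! ### The second map before reversal and complementation. -/

section SecondMap

theorem IsOutputSZ.apply_mem_descentBottoms_iff (h : IsOutputSZ σ τ) {j : Fin n} :
    τ j ∈ descentBottoms σ ↔ j ∈ descentTops σ :=
  apply_mem_iff_of_isGreedy (isOutputSZ_iff.1 h).1 (isOutputSZ_iff.1 h).2

theorem IsOutputSZ.apply_lt_iff (h : IsOutputSZ σ τ) {j : Fin n} :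
    τ j < j ↔ j ∈ descentTops σ := by
  refine ⟨fun hj => ?_, fun hj => (isOutputSZ_iff.1 h).1.rel hj⟩
  by_contra hT
  exact absurd hj (not_lt.2 ((isOutputSZ_iff.1 h).2.rel (Finset.mem_compl.2 hT)))

theorem IsOutputSZ.lt_inv_iff (h : IsOutputSZ σ τ) {x : Fin n} :
    x < τ⁻¹ x ↔ x ∈ descentBottoms σ := by
  have hx : τ (τ⁻¹ x) = x := τ.apply_symm_apply x
  have h1 := h.apply_lt_iff (j := τ⁻¹ x)
  rwa [← h.apply_mem_descentBottoms_iff, hx] at h1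

theorem IsOutputSZ.injective {σ' : Equiv.Perm (Fin n)} (h : IsOutputSZ σ τ)
    (h' : IsOutputSZ σ' τ) : σ = σ' := by
  have hT : descentTops σ = descentTops σ' := by
    ext x; rw [← h.apply_lt_iff, h'.apply_lt_iff]
  have hB : descentBottoms σ = descentBottoms σ' := by
    ext x; rw [← h.lt_inv_iff, h'.lt_inv_iff]
  refine eq_of_descents_of_pat312 hT hB fun x => ?_
  rw [isOutputSZ_iff] at h h'
  rw [← hT, ← hB] at h'
  by_cases hx : x ∈ descentTops σ
  · exact h.1.rank_eq h'.1 hx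
  · exact h.2.rank_eq h'.2 (Finset.mem_compl.2 hx)

/-- A value `j` that is not a descent bottom is still free at stage `j`, because the letters `i > j`
processed earlier take values at least `i`. It is the least admissible value, so it is chosen
exactly at rank zero. -/
theorem IsOutputSZ.apply_eq_iff (h : IsOutputSZ σ τ) {j : Fin n} :
    τ j = j ↔ j ∉ descentTops σ ∧ j ∉ descentBottoms σ ∧ pat312 j σ = 0 := by
  have hg := (isOutputSZ_iff.1 h).2
  constructor
  · intro hj
    have hT : j ∉ descentTops σ := fun hT => (h.apply_lt_iff.2 hT).ne hj
    refine ⟨hT, ?_, ?_⟩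
    · rwa [← h.apply_mem_descentBottoms_iff, hj] at hT
    · rw [hg.eq_zero_iff (Finset.mem_compl.2 hT)]
      intro y _ hy _
      rw [hj]
      exact not_lt.2 hy
  · rintro ⟨hT, hB, hp⟩
    have hle : j ≤ τ j := hg.rel (Finset.mem_compl.2 hT)
    rw [hg.eq_zero_iff (Finset.mem_compl.2 hT)] at hp
    refine le_antisymm (not_lt.1 (hp j (Finset.mem_compl.2 hB) le_rfl ?_)) hle
    intro i hi hji heq
    have : i ≤ τ i := hg.rel hi
    exact absurd (heq ▸ this) (not_le.2 hji)

/-- The left side is a pure excedance seen through reversal and complementation. A violating value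
`τ j` is a descent bottom: either it equals `t`, or it lies strictly between `τ t` and `t` and was
still free at stage `t`, so that `τ t` was not the largest choice. -/
theorem IsOutputSZ.pex_iff (h : IsOutputSZ σ τ) {t : Fin n} :
    (τ t < t ∧ ∀ j, t < j → ¬ (τ t ≤ τ j ∧ τ j ≤ t)) ↔
      t ∈ descentTops σ ∧ t ∉ descentBottoms σ ∧ pat312 t σ = 0 := by
  rw [h.apply_lt_iff]
  refine and_congr_right fun hT => ?_
  have hg := (isOutputSZ_iff.1 h).1
  rw [hg.eq_zero_iff hT]
  have htt := h.apply_lt_iff.2 hT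
  constructor
  · intro hpure
    constructor
    · intro hB
      refine hpure (τ⁻¹ t) (h.lt_inv_iff.2 hB) ?_
      rw [show τ (τ⁻¹ t) = t from τ.apply_symm_apply t]
      exact ⟨htt.le, le_rfl⟩
    · intro y hy hyt hch hlt
      have hτy : τ (τ⁻¹ y) = y := τ.apply_symm_apply y
      have hmem : τ⁻¹ y ∈ descentTops σ := by
        rwa [← h.apply_mem_descentBottoms_iff, hτy]
      have hle : t ≤ τ⁻¹ y := not_lt.1 fun hlt' => hch _ hmem hlt' hτy
      rcases hle.eq_or_lt with heq | hlt'
      · rw [heq, hτy] at hlt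
        exact lt_irrefl _ hlt
      · refine hpure _ hlt' ?_
        rw [hτy]
        exact ⟨le_of_lt hlt, le_of_lt hyt⟩
  · rintro ⟨hB, hz⟩ j hj ⟨h1, h2⟩
    have hjT : j ∈ descentTops σ := h.apply_lt_iff.1 (h2.trans_lt hj)
    have hjB := h.apply_mem_descentBottoms_iff.2 hjT
    refine hz (τ j) hjB (lt_of_le_of_ne h2 fun heq => hB (heq ▸ hjB)) ?_
      (lt_of_le_of_ne h1 fun heq => hj.ne (τ.injective heq))
    intro m _ hm heq
    exact absurd (hm.trans hj) (τ.injective heq ▸ lt_irrefl m)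

/-! ### Transport of the statistics through reversal and complementation. -/

theorem revCompl_apply (τ : Equiv.Perm (Fin n)) (i : Fin n) :
    revCompl τ i = Fin.rev (τ (Fin.rev i)) := rfl

theorem revCompl_involutive : Function.Involutive (revCompl (n := n)) := by
  intro τ
  ext i
  simp [revCompl_apply]

theorem exc_revCompl (τ : Equiv.Perm (Fin n)) :
    exc (revCompl τ) = (Finset.univ.filter fun j => τ j < j).card := by
  refine Finset.card_equiv Fin.revPerm fun i => ?_
  simp only [Finset.mem_filter, Finset.mem_univ, true_and]
  simp only [revCompl_apply, Fin.revPerm_apply]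
  rw [Fin.lt_rev_iff]

theorem fixCount_revCompl (τ : Equiv.Perm (Fin n)) : fixCount (revCompl τ) = fixCount τ := by
  refine Finset.card_equiv Fin.revPerm fun i => ?_
  simp only [Finset.mem_filter, Finset.mem_univ, true_and]
  simp only [revCompl_apply, Fin.revPerm_apply]
  rw [Fin.rev_eq_iff]

theorem pex_revCompl (τ : Equiv.Perm (Fin n)) :
    pex (revCompl τ) = (Finset.univ.filter fun t =>
      τ t < t ∧ ∀ j, t < j → ¬ (τ t ≤ τ j ∧ τ j ≤ t)).card := by
  refine Finset.card_equiv Fin.revPerm fun i => ?_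
  simp only [Finset.mem_filter, Finset.mem_univ, true_and]
  simp only [revCompl_apply, Fin.revPerm_apply]
  rw [Fin.lt_rev_iff]
  refine and_congr_right fun _ => ?_
  -- Reversing the bound position too turns `j < i` into the condition on positions to the right.
  rw [← Fin.revPerm.forall_congr_right]
  refine forall_congr' fun j => ?_
  simp only [Fin.revPerm_apply, Fin.rev_rev, Fin.rev_lt_iff, Fin.le_rev_iff]
  tauto

theorem IsOutputSZ.stats (h : IsOutputSZ σ τ) :
    des σ = exc (revCompl τ) ∧ des2 σ = pex (revCompl τ) ∧ fmax σ = fixCount (revCompl τ) := by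
  refine ⟨?_, ?_, ?_⟩
  · rw [exc_revCompl, ← card_descentTops]
    congr 1
    ext j
    simp [h.apply_lt_iff]
  · rw [pex_revCompl, des2_eq_card]
    congr 1
    ext j
    simp only [Finset.mem_filter, Finset.mem_univ, true_and, h.pex_iff]
  · rw [fixCount_revCompl, fmax_eq_card, fixCount]
    congr 1
    ext j
    simp only [Finset.mem_filter, Finset.mem_univ, true_and, h.apply_eq_iff]

end SecondMap

end PermStat

/-! ### Assembly of the two bijections. -/

theorem theorem1p8 (n : ℕ) :
    ∃ Φ₁ Φ₂ : Equiv.Perm (Fin n) → Equiv.Perm (Fin n),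
      Function.Bijective Φ₁ ∧ Function.Bijective Φ₂ ∧
      -- `Φ₁` and `Φ₂` are the maps given by the two explicit constructions
      (∀ σ τ, PermStat.IsOutput1 σ τ ↔ Φ₁ σ = τ) ∧
      (∀ σ τ, PermStat.IsOutputSZ σ τ ↔ Φ₂ σ = PermStat.revCompl τ) ∧
      (∀ σ, (PermStat.des σ, PermStat.des2 σ) =
        (PermStat.exc (Φ₁ σ), PermStat.ear (Φ₁ σ))) ∧
      (∀ σ, (PermStat.des σ, PermStat.des2 σ, PermStat.fmax σ) =
        (PermStat.exc (Φ₂ σ), PermStat.pex (Φ₂ σ), PermStat.fixCount (Φ₂ σ))) := by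
  choose F hF hFu using PermStat.existsUnique_isOutput1 (n := n)
  choose G hG hGu using PermStat.existsUnique_isOutputSZ (n := n)
  refine ⟨F, fun σ => PermStat.revCompl (G σ), ?_, ?_, ?_, ?_, ?_, ?_⟩
  · refine Finite.injective_iff_bijective.1 fun σ σ' h => ?_
    exact (hF σ).injective (h ▸ hF σ')
  · refine Finite.injective_iff_bijective.1 fun σ σ' h => ?_
    exact (hG σ).injective (PermStat.revCompl_involutive.injective h ▸ hG σ')
  · exact fun σ τ => ⟨fun h => (hFu σ τ h).symm, fun h => h ▸ hF σ⟩
  · refine fun σ τ => ⟨fun h => by rw [hGu σ τ h], fun h => ?_⟩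
    exact PermStat.revCompl_involutive.injective h ▸ hG σ
  · exact fun σ => Prod.ext (hF σ).des_eq_exc (hF σ).des2_eq_ear
  · intro σ
    obtain ⟨h1, h2, h3⟩ := (hG σ).stats
    rw [h1, h2, h3]
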